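/- Let $d\ge 1$, let $B_d=\{z\in\mathbb C^d:|z|<1\}$ be the open unit ball of $\mathbb C^d$ (with the Euclidean norm), and let $\sigma_d$ be the normalized Lebesgue measure on the unit sphere $\partial B_d$. For a holomorphic function $f$ on $B_d$ and $0\le r<1$ put $$M_p(f,r)=\left(\int_{\partial B_d}|f(r\zeta)|^p\,d\sigma_d(\zeta)\right)^{1/p}\quad(0<p<\infty),\qquad M_\infty(f,r)=\sup\{|f(z)|:|z|=r\}.$$ Let $w:[0,1)\to(0,+\infty)$ be a log-convex weight, that is, a continuous non-decreasing function such that $\log w(r)$ is a convex function of $\log r$ for $0<r<1$. Then there exists a holomorphic function $f$ on $B_d$ such that, for each $0<p\le\infty$, $M_p(f,\cdot)$ and $w$ are equivalent on $[0,1)$: there exist constants $C_1,C_2>0$ (which may depend on $p$) with $$C_1M_p(f,r)\le w(r)\le C_2M_p(f,r)\quad\text{for all }0\le r<1.$$ -/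

import Mathlib

open MeasureTheory Set
open scoped ENNReal

noncomputable section

/-- The space `ℂ^d` with its Euclidean norm. -/
abbrev Cd (d : ℕ) : Type := EuclideanSpace ℂ (Fin d)

/-- The normalized Lebesgue (surface) measure on the unit sphere of `ℂ^d`. -/
def sphereMeasure (d : ℕ) : Measure (Metric.sphere (0 : Cd d) 1) :=
  ((volume : Measure (Cd d)).toSphere univ)⁻¹ • (volume : Measure (Cd d)).toSphere

/-- The holomorphic functions on the open unit ball of `ℂ^d`
(the values outside the ball play no role). -/
def HolBall (d : ℕ) (f : Cd d → ℂ) : Prop :=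
  DifferentiableOn ℂ f (Metric.ball 0 1)

/-- The integral means `M_p(f, r)`: the `L^p` mean over the sphere for `0 < p < ∞`,
and the maximum of `|f|` over `|z| = r` for `p = ∞`. -/
def integralMean {d : ℕ} (p : ℝ≥0∞) (f : Cd d → ℂ) (r : ℝ) : ℝ :=
  if p = ∞ then sSup ((fun z => ‖f z‖) '' Metric.sphere (0 : Cd d) r)
  else (∫ ζ : Metric.sphere (0 : Cd d) 1,
    ‖f ((r : ℂ) • (ζ : Cd d))‖ ^ p.toReal ∂(sphereMeasure d)) ^ (1 / p.toReal)

/-- A weight on `[0,1)`: a positive, continuous, non-decreasing function. -/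
structure IsWeight (w : ℝ → ℝ) : Prop where
  pos : ∀ r ∈ Ico (0 : ℝ) 1, 0 < w r
  continuousOn : ContinuousOn w (Ico 0 1)
  monotoneOn : MonotoneOn w (Ico 0 1)

/-- A weight is log-convex if `log w(r)` is a convex function of `t = log r`, `0 < r < 1`. -/
structure IsLogConvexWeight (w : ℝ → ℝ) : Prop extends IsWeight w where
  convexOn : ConvexOn ℝ (Iio 0) (fun t => Real.log (w (Real.exp t)))

/-- Equivalence `u ≍ v` of two functions on a set `X`. -/
def EquivOn {α : Type*} (X : Set α) (u v : α → ℝ) : Prop :=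
  ∃ C₁ C₂ : ℝ, 0 < C₁ ∧ 0 < C₂ ∧ ∀ x ∈ X, C₁ * u x ≤ v x ∧ v x ≤ C₂ * u x

end

/-! ### Integer-slope supporting lines of a convex function -/

section ConvexTangents

open Filter Topology

/-! In the variable `t = log r` a power series with nonnegative coefficients is, up to bounded
factors, the exponential of a supremum of affine functions with integer slopes. If `w` is bounded, a
constant series suffices. Otherwise `φ t = log w(exp t)` tends to infinity at `0` and has a
supporting line of every positive integer slope. Choosing slopes greedily, each the first one well
separated from its predecessor, gives lines that stay within a bounded distance of `φ` yet decay
geometrically in index away from the dominant one (`exists_lacunary_affine`). So both the sum and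
the largest term of `∑ a k * r ^ n k` are comparable to `w r`
(`IsLogConvexWeight.exists_power_series`).

To pass to the ball, `r ^ n` is multiplied by a homogeneous polynomial of degree `n` that is bounded
on the sphere independently of `n` and whose `L²` mean is bounded below
(`exists_bounded_homogeneous`). It is a signed sum of powers `⟨x, z⟩ ^ n` over a maximal separated
set of complex lines: packing bounds the sum, maximality and a choice of signs keep the `L²` mean
large.

The resulting `f` satisfies `|f| ≲ w r` on the sphere of radius `r`. Different degrees are
orthogonal, so its `L²` mean is at least that of its largest term, hence `≳ w r`. A function with
comparable sup bound and `L²` mean has all its `L^p` means comparable to them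
(`integralMean_bounds`), with constants independent of `r`. -/

/-- A function on the negative half-line that is bounded below and blows up at `0` admits a
supporting line of each positive integer slope. -/
lemma exists_supporting_line {φ : ℝ → ℝ} {L : ℝ} (hcont : ContinuousOn φ (Iio 0))
    (hL : ∀ t < 0, L ≤ φ t) (htop : Tendsto φ (𝓝[<] 0) atTop) {n : ℕ} (hn : 1 ≤ n) :
    ∃ τ < 0, ∀ t < 0, φ τ + n * (t - τ) ≤ φ t := by
  have hn' : (1 : ℝ) ≤ n := by exact_mod_cast hn
  set M : ℝ := φ (-1) + n with hM
  obtain ⟨l, hl0, hl⟩ := (mem_nhdsLT_iff_exists_Ioo_subset).1 (htop.eventually_ge_atTop M)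
  set δ : ℝ := max l (-1) with hδ
  have hδ0 : δ < 0 := max_lt hl0 (by norm_num)
  -- Outside `[R, δ]` the function `φ t - n * t` is at least `M`, its value at `-1`: on the left by
  -- the lower bound `L` and `n ≥ 1`, on the right by the blow-up. A minimum over the compact
  -- interval is therefore global.
  set R : ℝ := min (-1) (L - M) with hR
  have hsub : Icc R δ ⊆ Iio 0 := fun t ht => lt_of_le_of_lt ht.2 hδ0
  have h1 : (-1 : ℝ) ∈ Icc R δ := ⟨min_le_left _ _, le_max_right _ _⟩
  obtain ⟨τ, hτ, hmin⟩ := isCompact_Icc.exists_isMinOn ⟨_, h1⟩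
    (f := fun t => φ t - n * t) ((hcont.mono hsub).sub (by fun_prop))
  have hmin' : ∀ t ∈ Icc R δ, φ τ - n * τ ≤ φ t - n * t := fun t ht => hmin ht
  have hτ1 : φ τ - n * τ ≤ M := by
    have := hmin' _ h1
    rw [hM]; linarith
  refine ⟨τ, hsub hτ, fun t ht => ?_⟩
  suffices φ τ - n * τ ≤ φ t - n * t by linarith
  rcases lt_or_ge t R with h | h
  · have h2 : t ≤ L - M := h.le.trans (min_le_right _ _)
    have := hL t ht
    nlinarith
  rcases le_or_gt t δ with h' | h'
  · exact hmin' t ⟨h, h'⟩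
  · have : M ≤ φ t := hl ⟨lt_of_le_of_lt (le_max_left _ _) h', ht⟩
    nlinarith

/-- `SupportingLines φ τ`: for each integer `n ≥ 1` the line of slope `n` through the point of the
graph of `φ` over `τ n < 0` stays below `φ` on the negative half-line. -/
structure SupportingLines (φ : ℝ → ℝ) (τ : ℕ → ℝ) : Prop where
  neg : ∀ n, 1 ≤ n → τ n < 0
  le : ∀ n, 1 ≤ n → ∀ t < 0, φ (τ n) + n * (t - τ n) ≤ φ t

/-- The supporting line of slope `n`. -/
noncomputable def supportLine (φ : ℝ → ℝ) (τ : ℕ → ℝ) (n : ℕ) (t : ℝ) : ℝ :=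
  φ (τ n) + n * (t - τ n)

/-- The lines of slopes `m` and `n` lie well below `φ` at each other's contact point. -/
def Separates (φ : ℝ → ℝ) (τ : ℕ → ℝ) (m n : ℕ) : Prop :=
  supportLine φ τ n (τ m) ≤ φ (τ m) - 1 ∧ supportLine φ τ m (τ n) ≤ φ (τ n) - 1

lemma supportLine_self (φ : ℝ → ℝ) (τ : ℕ → ℝ) (n : ℕ) : supportLine φ τ n (τ n) = φ (τ n) := by
  simp [supportLine]

namespace SupportingLines

variable {φ : ℝ → ℝ} {τ : ℕ → ℝ} (h : SupportingLines φ τ)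
include h

/-- Adding the two support inequalities, each at the other's contact point, gives `(n - m) * (τ n -
τ m) ≥ 0`. -/
lemma contact_mono {m n : ℕ} (hm : 1 ≤ m) (hmn : m ≤ n) : τ m ≤ τ n := by
  rcases hmn.eq_or_lt with rfl | hlt
  · exact le_rfl
  have h1 := h.le m hm (τ n) (h.neg n (hm.trans hmn))
  have h2 := h.le n (hm.trans hmn) (τ m) (h.neg m hm)
  have h3 : (m : ℝ) < n := by exact_mod_cast hlt
  by_contra! h4
  nlinarith

/-- If `τ n ≤ T`, the line of slope `n` rises from at least `L` to at least `L - n * T / 2` at `T /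
2`, overtaking `φ (T / 2)` once `n` is large. -/
lemma eventually_lt_contact {L : ℝ} (hL : ∀ t < 0, L ≤ φ t) {T : ℝ} (hT : T < 0) :
    ∀ᶠ n in atTop, T < τ n := by
  filter_upwards [eventually_ge_atTop 1,
    tendsto_natCast_atTop_atTop.eventually_gt_atTop ((φ (T / 2) - L) / (-T / 2))] with n hn1 hn
  rw [div_lt_iff₀ (by linarith)] at hn
  by_contra! h1
  have h2 := h.le n hn1 (T / 2) (by linarith)
  have h3 := hL _ (h.neg n hn1)
  have h4 : (1 : ℝ) ≤ n := by exact_mod_cast hn1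
  nlinarith

lemma tendsto_contact {L : ℝ} (hL : ∀ t < 0, L ≤ φ t) : Tendsto τ atTop (𝓝[<] 0) := by
  refine tendsto_nhdsWithin_iff.2 ⟨?_, (eventually_ge_atTop 1).mono fun n hn => h.neg n hn⟩
  refine tendsto_order.2 ⟨fun a ha => h.eventually_lt_contact hL ha, fun a ha => ?_⟩
  exact (eventually_ge_atTop 1).mono fun n hn => (h.neg n hn).trans ha

/-- A steep line lying below `φ` at `τ m / 2` is very low at `τ m`, whereas the line of slope `m`
stays bounded near `0` and `φ (τ n)` blows up. -/
lemma exists_separates {L : ℝ} (hL : ∀ t < 0, L ≤ φ t) (htop : Tendsto φ (𝓝[<] 0) atTop)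
    {m : ℕ} (hm : 1 ≤ m) : ∃ n, m ≤ n ∧ Separates φ τ m n := by
  have hτm := h.neg m hm
  have e1 : ∀ᶠ n : ℕ in atTop, supportLine φ τ n (τ m) ≤ φ (τ m) - 1 := by
    filter_upwards [eventually_ge_atTop 1, tendsto_natCast_atTop_atTop.eventually_gt_atTop
      ((φ (τ m / 2) - φ (τ m) + 1) / (-τ m / 2))] with n hn1 hn
    rw [div_lt_iff₀ (by linarith)] at hn
    have := h.le n hn1 (τ m / 2) (by linarith)
    unfold supportLine
    nlinarith
  have e2 : ∀ᶠ n : ℕ in atTop, supportLine φ τ m (τ n) ≤ φ (τ n) - 1 := by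
    filter_upwards [eventually_ge_atTop 1, (htop.comp (h.tendsto_contact hL)).eventually_ge_atTop
      (φ (τ m) + m * (0 - τ m) + 1)] with n hn1 hn
    have h1 := h.neg n hn1
    have h2 : (1 : ℝ) ≤ m := by exact_mod_cast hm
    simp only [Function.comp] at hn
    unfold supportLine
    nlinarith
  obtain ⟨n, hn⟩ := ((eventually_ge_atTop m).and (e1.and e2)).exists
  exact ⟨n, hn⟩

/-- Between consecutive contact points of a minimal separated pair of lines, one of the two lines
is within a bounded distance of `φ`. -/
lemma le_supportLine_or (hconv : ConvexOn ℝ (Iio 0) φ) {m n : ℕ} (hm : 1 ≤ m) (hmn : m < n)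
    (hmin : ∀ q, m ≤ q → q < n → ¬ Separates φ τ m q) {t : ℝ} (ht : t ∈ Icc (τ m) (τ n)) :
    φ t - (1 - τ 1) ≤ supportLine φ τ m t ∨ φ t - (1 - τ 1) ≤ supportLine φ τ n t := by
  obtain ⟨q, rfl⟩ : ∃ q, n = q + 1 := ⟨n - 1, by omega⟩
  have hmq : m ≤ q := by omega
  have hq : 1 ≤ q := hm.trans hmq
  have hτm := h.neg m hm
  have hτq := h.neg q hq
  have hτn := h.neg (q + 1) (by omega)
  have h1m := h.contact_mono le_rfl hm
  -- The gap between `φ` and a line is convex, so it is controlled at the ends of an interval.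
  have hgap : ∀ (k : ℕ) {x y z : ℝ}, x < 0 → y < 0 → z ∈ Icc x y →
      φ z - supportLine φ τ k z ≤ max (φ x - supportLine φ τ k x) (φ y - supportLine φ τ k y) := by
    intro k x y z hx hy hz
    have hc : ConvexOn ℝ (Iio 0) (fun t => φ t - supportLine φ τ k t) := by
      refine hconv.sub ?_
      refine ⟨convex_Iio 0, fun x _ y _ a b _ _ hab => le_of_eq ?_⟩
      simp only [supportLine, smul_eq_mul]
      have : b = 1 - a := by linarith
      subst this
      ring
    exact hc.le_max_of_mem_Icc hx hy hz
  have htau : τ 1 ≤ t := h1m.trans ht.1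
  -- With `q = n - 1`, passing from slope `q` to `q + 1` costs at most `τ (q + 1) - t ≤ -τ 1`. This
  -- is where the slopes being consecutive integers matters, and it gives the error `1 - τ 1`.
  have hcmp : supportLine φ τ q t - (τ (q + 1) - t) ≤ supportLine φ τ (q + 1) t := by
    have := h.le q hq (τ (q + 1)) hτn
    unfold supportLine
    push_cast
    linarith
  rcases le_total t (τ q) with htq | htq
  · have hns := hmin q hmq (by omega)
    rw [Separates, not_and_or, not_le, not_le] at hns
    rcases hns with hns | hns
    · right
      have := hgap q hτm hτq ⟨ht.1, htq⟩
      rw [supportLine_self, sub_self] at this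
      have := this.trans (max_le (by linarith : _ ≤ (1 : ℝ)) zero_le_one)
      linarith
    · left
      have := hgap m hτm hτq ⟨ht.1, htq⟩
      rw [supportLine_self, sub_self] at this
      have := this.trans (max_le zero_le_one (by linarith : _ ≤ (1 : ℝ)))
      linarith
  · right
    have := hgap q hτq hτn ⟨htq, ht.2⟩
    have h3 := h.le q hq (τ (q + 1)) hτn
    rw [supportLine_self, sub_self, max_eq_right (by unfold supportLine; linarith)] at this
    unfold supportLine at this ⊢
    push_cast
    linarith

end SupportingLines

/-- A convex function on the negative half-line that is bounded below and blows up at `0` is, up to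
bounded errors, the supremum of a sequence of affine functions with increasing integer slopes
which decay geometrically away from the dominating one. -/
lemma exists_lacunary_affine {L : ℝ} {φ : ℝ → ℝ} (hconv : ConvexOn ℝ (Iio 0) φ)
    (hmono : MonotoneOn φ (Iio 0)) (hL : ∀ t < 0, L ≤ φ t) (htop : Tendsto φ (𝓝[<] 0) atTop) :
    ∃ (n : ℕ → ℕ) (b : ℕ → ℝ) (A D : ℝ), StrictMono n ∧ 0 < n 0 ∧
      (∀ t < 0, ∃ K : ℕ, ∀ j : ℕ, b j + n j * t ≤ φ t + 1 - |(j : ℝ) - K|) ∧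
      ∀ t < 0, φ t ≤ A ∨ ∃ k, φ t - D ≤ b k + n k * t := by
  have hcont : ContinuousOn φ (Iio 0) := hconv.continuousOn isOpen_Iio
  have hex : ∀ n : ℕ, 1 ≤ n → ∃ τ < 0, ∀ t < 0, φ τ + n * (t - τ) ≤ φ t := fun n hn =>
    exists_supporting_line hcont hL htop hn
  choose! τ hneg hle using hex
  have h : SupportingLines φ τ := ⟨hneg, hle⟩
  have hnext : ∀ m : ℕ, 1 ≤ m → ∃ n, m < n ∧ Separates φ τ m n ∧
      ∀ q, m ≤ q → q < n → ¬ Separates φ τ m q := by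
    intro m hm
    classical
    have hE := h.exists_separates hL htop hm
    obtain ⟨h1, h2⟩ := Nat.find_spec hE
    refine ⟨Nat.find hE, lt_of_le_of_ne h1 ?_, h2, fun q hq hqn hs => Nat.find_min hE hqn ⟨hq, hs⟩⟩
    intro heq
    have := h2.1
    rw [← heq, supportLine_self] at this
    linarith
  choose! next hlt hsep hmin using hnext
  set N : ℕ → ℕ := fun k => next^[k] 1 with hN
  have hNs : ∀ k, N (k + 1) = next (N k) := fun k => Function.iterate_succ_apply' _ _ _
  have hN1 : ∀ k, 1 ≤ N k := by
    intro k
    induction k with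
    | zero => exact le_rfl
    | succ k ih => rw [hNs]; exact ih.trans (hlt _ ih).le
  have hNm : StrictMono N := strictMono_nat_of_lt_succ fun k => by rw [hNs]; exact hlt _ (hN1 k)
  have hslope : ∀ k, (N k : ℝ) ≤ N (k + 1) := fun k => by exact_mod_cast (hNm (Nat.lt_succ_self k)).le
  have hsepN : ∀ k, Separates φ τ (N k) (N (k + 1)) := fun k => by rw [hNs]; exact hsep _ (hN1 k)
  have hτN : ∀ k j, k ≤ j → τ (N k) ≤ τ (N j) := fun k j hkj =>
    h.contact_mono (hN1 k) (hNm.monotone hkj)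
  -- Separation loses one unit per index at a contact point; the ordering of slopes preserves that
  -- loss on the far side.
  have hleft : ∀ i j t, τ (N (j + i)) ≤ t →
      supportLine φ τ (N j) t ≤ supportLine φ τ (N (j + i)) t - i := by
    intro i
    induction i with
    | zero => intro j t _; simp
    | succ i ih =>
      intro j t ht
      have h1 := ih (j + 1) t (by rwa [show j + 1 + i = j + (i + 1) by ring])
      rw [show j + 1 + i = j + (i + 1) by ring] at h1
      have h2 := (hsepN j).2
      have h3 : τ (N (j + 1)) ≤ t := (hτN _ _ (by omega)).trans ht
      have h4 := hslope j
      unfold supportLine at h1 h2 ⊢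
      push_cast
      nlinarith
  have hright : ∀ i k t, t ≤ τ (N k) →
      supportLine φ τ (N (k + i)) t ≤ supportLine φ τ (N k) t - i := by
    intro i
    induction i with
    | zero => intro j t _; simp
    | succ i ih =>
      intro k t ht
      have h1 := ih k t ht
      have h2 := (hsepN (k + i)).1
      have h3 : t ≤ τ (N (k + i)) := ht.trans (hτN _ _ (by omega))
      have h4 := hslope (k + i)
      rw [← add_assoc]
      unfold supportLine at h1 h2 ⊢
      push_cast
      nlinarith
  have hloc : ∀ t < 0, t < τ (N 0) ∨ ∃ k, t ∈ Icc (τ (N k)) (τ (N (k + 1))) := by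
    intro t ht
    classical
    have hE : ∃ k, t < τ (N k) :=
      (hNm.tendsto_atTop.eventually (h.eventually_lt_contact hL ht)).exists
    have h1 := Nat.find_spec hE
    rcases hk : Nat.find hE with _ | k
    · left; rwa [hk] at h1
    · right
      refine ⟨k, not_lt.1 (Nat.find_min hE (by omega)), ?_⟩
      rw [hk] at h1
      exact h1.le
  have hline : ∀ j t, φ (τ (N j)) - N j * τ (N j) + N j * t = supportLine φ τ (N j) t := by
    intro j t; unfold supportLine; ring
  have hbelow : ∀ j, ∀ t < 0, supportLine φ τ (N j) t ≤ φ t := fun j t ht => h.le _ (hN1 j) t ht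
  refine ⟨N, fun k => φ (τ (N k)) - N k * τ (N k), φ (τ 1), 1 - τ 1, hNm, hN1 0, ?_, ?_⟩
  · intro t ht
    simp only [hline]
    rcases hloc t ht with h0 | ⟨k, hk⟩
    · refine ⟨0, fun j => ?_⟩
      have h1 := hright j 0 t h0.le
      have h2 := hbelow 0 t ht
      rw [zero_add] at h1
      rw [Nat.cast_zero, sub_zero, abs_of_nonneg (Nat.cast_nonneg j)]
      linarith
    · refine ⟨k, fun j => ?_⟩
      rcases le_or_gt j k with hj | hj
      · obtain ⟨i, rfl⟩ := Nat.exists_eq_add_of_le hj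
        have h1 := hleft i j t hk.1
        have h2 := hbelow (j + i) t ht
        push_cast
        rw [show (j : ℝ) - (j + i) = -i by ring, abs_neg, abs_of_nonneg (Nat.cast_nonneg i)]
        linarith
      · obtain ⟨i, rfl⟩ := Nat.exists_eq_add_of_le (Nat.succ_le_of_lt hj)
        have h1 := hright i (k + 1) t hk.2
        have h2 := hbelow (k + 1) t ht
        push_cast
        -- Lines beyond `k` are compared with line `k + 1`, not `k`; this shift by one is the `+ 1`
        -- in the upper bound.
        rw [show (k : ℝ) + 1 + i - k = i + 1 by ring, abs_of_nonneg (by positivity)]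
        rw [Nat.succ_eq_add_one]
        linarith
  · intro t ht
    simp only [hline]
    rcases hloc t ht with h0 | ⟨k, hk⟩
    · exact Or.inl (hmono ht (h.neg 1 le_rfl) h0.le)
    · right
      rcases h.le_supportLine_or hconv (hN1 k) (hNm (Nat.lt_succ_self k))
        (by rw [Nat.succ_eq_add_one, hNs]; exact hmin _ (hN1 k)) hk with h1 | h1
      · exact ⟨k, h1⟩
      · exact ⟨k + 1, h1⟩

end ConvexTangents

/-! ### From affine functions to a power series comparable to the weight -/

lemma summable_exp_neg_abs_int : Summable fun i : ℤ => Real.exp (-|(i : ℝ)|) := by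
  refine Summable.of_nat_of_neg ?_ ?_ <;>
  · simpa using Real.summable_exp_neg_nat

lemma summable_exp_neg_abs_sub (K : ℕ) : Summable fun j : ℕ => Real.exp (-|(j : ℝ) - K|) := by
  have hinj : Function.Injective fun j : ℕ => (j : ℤ) - K := fun a b hab => by simpa using hab
  exact (summable_exp_neg_abs_int.comp_injective hinj).congr fun j => by simp

lemma tsum_exp_neg_abs_sub_le (K : ℕ) :
    ∑' j : ℕ, Real.exp (-|(j : ℝ) - K|) ≤ ∑' i : ℤ, Real.exp (-|(i : ℝ)|) := by
  have hinj : Function.Injective fun j : ℕ => (j : ℤ) - K := fun a b hab => by simpa using hab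
  refine le_of_eq_of_le ?_
    (tsum_comp_le_tsum_of_inj summable_exp_neg_abs_int (fun i => (Real.exp_pos _).le) hinj)
  exact tsum_congr fun j => by simp

/-- A log-convex weight is equivalent both to the sum and to the largest term of a power series
with nonnegative coefficients. -/
lemma IsLogConvexWeight.exists_power_series {w : ℝ → ℝ} (hw : IsLogConvexWeight w) :
    ∃ (n : ℕ → ℕ) (a : ℕ → ℝ) (c C : ℝ), StrictMono n ∧ (∀ k, 0 ≤ a k) ∧ 0 < c ∧ 0 < C ∧
      ∀ r ∈ Ico (0 : ℝ) 1, (Summable fun k => a k * r ^ n k) ∧ ∑' k, a k * r ^ n k ≤ C * w r ∧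
        ∃ k, c * w r ≤ a k * r ^ n k := by
  have h0mem : (0 : ℝ) ∈ Ico (0 : ℝ) 1 := ⟨le_rfl, one_pos⟩
  have hw0 := hw.pos 0 h0mem
  have hw0le : ∀ r ∈ Ico (0 : ℝ) 1, w 0 ≤ w r := fun r hr => hw.monotoneOn h0mem hr hr.1
  by_cases hb : ∃ B, ∀ r ∈ Ico (0 : ℝ) 1, w r ≤ B
  · obtain ⟨B, hB⟩ := hb
    have hBpos : 0 < B := hw0.trans_le (hB 0 h0mem)
    refine ⟨id, Pi.single 0 (w 0), w 0 / B, 1, strictMono_id, fun k => ?_, by positivity, one_pos,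
      fun r hr => ?_⟩
    · by_cases hk : k = 0
      · subst hk; simpa using hw0.le
      · simp [hk]
    · have hz : ∀ k ≠ 0, (Pi.single 0 (w 0) : ℕ → ℝ) k * r ^ id k = 0 := fun k hk => by simp [hk]
      refine ⟨summable_of_ne_finset_zero (s := {0}) fun k hk => hz k (by simpa using hk), ?_, 0, ?_⟩
      · rw [tsum_eq_single 0 hz]
        simpa using hw0le r hr
      · simp only [Pi.single_eq_same, id, pow_zero, mul_one]
        rw [div_mul_eq_mul_div, div_le_iff₀ hBpos]
        exact mul_le_mul_of_nonneg_left (hB r hr) hw0.le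
  push Not at hb
  set φ : ℝ → ℝ := fun t => Real.log (w (Real.exp t)) with hφ
  have hexp : ∀ t < 0, Real.exp t ∈ Ico (0 : ℝ) 1 := fun t ht =>
    ⟨(Real.exp_pos t).le, Real.exp_lt_one_iff.2 ht⟩
  have hexpφ : ∀ t < 0, Real.exp (φ t) = w (Real.exp t) := fun t ht =>
    Real.exp_log (hw.pos _ (hexp t ht))
  have hmono : MonotoneOn φ (Iio 0) := fun s hs t ht hst =>
    Real.log_le_log (hw.pos _ (hexp s hs))
      (hw.monotoneOn (hexp s hs) (hexp t ht) (Real.exp_le_exp.2 hst))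
  have hL : ∀ t < 0, Real.log (w 0) ≤ φ t := fun t ht =>
    Real.log_le_log hw0 (hw0le _ (hexp t ht))
  have htop : Filter.Tendsto φ (nhdsWithin 0 (Iio 0)) Filter.atTop := by
    refine Filter.tendsto_atTop.2 fun b => ?_
    obtain ⟨r, hr, hrb⟩ := hb (max (w 0) (Real.exp b))
    have hr0 : 0 < r := by
      refine lt_of_le_of_ne hr.1 fun h => ?_
      rw [← h] at hrb
      exact absurd hrb (not_lt.2 (le_max_left _ _))
    have hlog : Real.log r < 0 := Real.log_neg hr0 hr.2
    filter_upwards [Ioo_mem_nhdsLT hlog] with t ht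
    have h1 : w r ≤ w (Real.exp t) := hw.monotoneOn hr (hexp t ht.2)
      ((Real.log_lt_iff_lt_exp hr0).1 ht.1).le
    exact (Real.le_log_iff_exp_le (hw.pos _ (hexp t ht.2))).2
      (((le_max_right _ _).trans hrb.le).trans h1)
  obtain ⟨n, b, A, D, hn, hn0, hup, hlow⟩ := exists_lacunary_affine (φ := φ) hw.convexOn hmono hL htop
  set S : ℝ := ∑' i : ℤ, Real.exp (-|(i : ℝ)|) with hS
  have hS0 : 0 ≤ S := tsum_nonneg fun i => (Real.exp_pos _).le
  -- A constant term `w 0` is prepended: it handles `r = 0` and the range `φ ≤ A`, where no line is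
  -- known to be close to `φ`.
  set n' : ℕ → ℕ := fun k => Nat.casesOn k 0 n with hn'
  set a : ℕ → ℝ := fun k => Nat.casesOn k (w 0) (fun j => Real.exp (b j)) with ha
  have hterm : ∀ t < 0, ∀ j, Real.exp (b j) * Real.exp t ^ n j = Real.exp (b j + n j * t) :=
    fun t _ j => by rw [Real.exp_add, ← Real.exp_nat_mul]
  refine ⟨n', a, min (w 0 / Real.exp A) (min (Real.exp (-D)) 1), 1 + Real.exp 1 * S, ?_, ?_, ?_,
    by positivity, ?_⟩
  · refine strictMono_nat_of_lt_succ fun k => ?_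
    cases k with
    | zero => exact hn0
    | succ k => exact hn (Nat.lt_succ_self k)
  · intro k
    cases k with
    | zero => exact hw0.le
    | succ k => exact (Real.exp_pos _).le
  · exact lt_min (by positivity) (lt_min (Real.exp_pos _) one_pos)
  intro r hr
  have hwr := hw.pos r hr
  have htail : (Summable fun j => Real.exp (b j) * r ^ n j) ∧
      ∑' j, Real.exp (b j) * r ^ n j ≤ Real.exp 1 * S * w r := by
    rcases hr.1.eq_or_lt with rfl | hr0
    · have : ∀ j, Real.exp (b j) * (0 : ℝ) ^ n j = 0 := fun j => by
        rw [zero_pow (hn0.trans_le (hn.monotone (Nat.zero_le j))).ne', mul_zero]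
      simp only [this]
      exact ⟨summable_zero, by rw [tsum_zero]; positivity⟩
    · have ht : Real.log r < 0 := Real.log_neg hr0 hr.2
      obtain ⟨K, hK⟩ := hup _ ht
      have hle : ∀ j, Real.exp (b j) * r ^ n j ≤
          Real.exp 1 * w r * Real.exp (-|(j : ℝ) - K|) := by
        intro j
        have h1 := Real.exp_le_exp.2 (hK j)
        rw [← hterm _ ht, Real.exp_log hr0] at h1
        refine h1.trans (le_of_eq ?_)
        rw [sub_eq_add_neg, Real.exp_add, Real.exp_add, hexpφ _ ht, Real.exp_log hr0]
        ring
      have hsum := (summable_exp_neg_abs_sub K).mul_left (Real.exp 1 * w r)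
      have hsum' := Summable.of_nonneg_of_le (fun j => by positivity) hle hsum
      refine ⟨hsum', (hsum'.tsum_le_tsum hle hsum).trans ?_⟩
      rw [tsum_mul_left]
      calc Real.exp 1 * w r * ∑' j : ℕ, Real.exp (-|(j : ℝ) - K|) ≤ Real.exp 1 * w r * S := by
            gcongr
            exact tsum_exp_neg_abs_sub_le K
        _ = _ := by ring
  have hsum : Summable fun k => a k * r ^ n' k := (summable_nat_add_iff 1).1 htail.1
  refine ⟨hsum, ?_, ?_⟩
  · rw [hsum.tsum_eq_zero_add]
    have h1 : a 0 * r ^ n' 0 = w 0 := by simp [ha, hn']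
    rw [h1]
    linarith [htail.2, hw0le r hr]
  · rcases hr.1.eq_or_lt with rfl | hr0
    · refine ⟨0, ?_⟩
      have : a 0 * (0 : ℝ) ^ n' 0 = w 0 := by simp [ha, hn']
      rw [this]
      exact mul_le_of_le_one_left hw0.le ((min_le_right _ _).trans (min_le_right _ _))
    have ht : Real.log r < 0 := Real.log_neg hr0 hr.2
    have hφr : φ (Real.log r) = Real.log (w r) := by simp only [hφ, Real.exp_log hr0]
    rcases hlow _ ht with h1 | ⟨k, hk⟩
    · refine ⟨0, ?_⟩
      have h2 : a 0 * r ^ n' 0 = w 0 := by simp [ha, hn']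
      rw [h2]
      rw [hφr, Real.log_le_iff_le_exp hwr] at h1
      calc _ ≤ w 0 / Real.exp A * w r := by gcongr; exact min_le_left _ _
        _ ≤ w 0 / Real.exp A * Real.exp A := by gcongr
        _ = w 0 := by field_simp
    · refine ⟨k + 1, ?_⟩
      have h2 : a (k + 1) * r ^ n' (k + 1) = Real.exp (b k) * Real.exp (Real.log r) ^ n k := by
        rw [Real.exp_log hr0]
      rw [h2, hterm _ ht]
      refine le_trans ?_ (Real.exp_le_exp.2 hk)
      rw [sub_eq_add_neg, Real.exp_add, hφr, Real.exp_log hwr, mul_comm]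
      gcongr
      exact (min_le_right _ _).trans (min_le_left _ _)

/-! ### Volume packing -/

/-- The cardinality of a separated family of points in a ball is controlled by volume. -/
lemma card_le_of_separated_of_mem_closedBall {E ι : Type*} [NormedAddCommGroup E] [NormedSpace ℝ E]
    [FiniteDimensional ℝ E] (s : Finset ι) (F : ι → E) (x : E) {R δ : ℝ} (hR : 0 ≤ R) (hδ : 0 < δ)
    (hF : ∀ i ∈ s, ‖F i - x‖ ≤ R) (hsep : ∀ i ∈ s, ∀ j ∈ s, i ≠ j → δ ≤ ‖F i - F j‖) :
    (s.card : ℝ) ≤ ((2 * R + δ) / δ) ^ Module.finrank ℝ E := by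
  borelize E
  let μ : Measure E := Measure.addHaar
  have hδ2 : 0 < δ / 2 := by positivity
  have hρ : 0 < R + δ / 2 := by positivity
  have D : (s : Set ι).Pairwise (Function.onFun Disjoint fun i => Metric.ball (F i) (δ / 2)) := by
    intro i hi j hj hij
    apply Metric.ball_disjoint_ball
    rw [dist_eq_norm]
    linarith [hsep i hi j hj hij]
  have hsub : (⋃ i ∈ s, Metric.ball (F i) (δ / 2)) ⊆ Metric.ball x (R + δ / 2) := by
    refine iUnion₂_subset fun i hi => Metric.ball_subset_ball' ?_
    rw [dist_eq_norm]
    linarith [hF i hi]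
  have I : (s.card : ℝ≥0∞) * ENNReal.ofReal ((δ / 2) ^ Module.finrank ℝ E) * μ (Metric.ball 0 1) ≤
      ENNReal.ofReal ((R + δ / 2) ^ Module.finrank ℝ E) * μ (Metric.ball 0 1) := by
    calc _ = μ (⋃ i ∈ s, Metric.ball (F i) (δ / 2)) := by
          rw [measure_biUnion_finset D fun c _ => measurableSet_ball]
          simp only [μ.addHaar_ball_of_pos _ hδ2, Finset.sum_const, nsmul_eq_mul, mul_assoc]
      _ ≤ μ (Metric.ball x (R + δ / 2)) := measure_mono hsub
      _ = _ := by rw [μ.addHaar_ball_of_pos _ hρ]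
  have J := (ENNReal.mul_le_mul_iff_left (Metric.measure_ball_pos μ _ zero_lt_one).ne'
    measure_ball_lt_top.ne).1 I
  have K := ENNReal.toReal_le_of_le_ofReal (pow_nonneg hρ.le _) J
  rw [ENNReal.toReal_mul, ENNReal.toReal_natCast, ENNReal.toReal_ofReal (by positivity),
    ← le_div_iff₀ (by positivity), ← div_pow] at K
  refine K.trans (le_of_eq ?_)
  congr 1
  field_simp

/-! ### Choice of signs -/

section Signs

variable {α ι : Type*} [TopologicalSpace α] [CompactSpace α] [MeasurableSpace α]
  [OpensMeasurableSpace α]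

lemma Continuous.integrable_of_compactSpace {F : Type*} [NormedAddCommGroup F]
    [SecondCountableTopology F] {μ : Measure α} [IsFiniteMeasure μ] {g : α → F}
    (hg : Continuous g) : Integrable g μ := by
  borelize F
  obtain ⟨C, hC⟩ := isCompact_univ.exists_bound_of_continuousOn hg.continuousOn
  exact Integrable.of_bound hg.measurable.aestronglyMeasurable C
    (Filter.Eventually.of_forall fun x => hC x (mem_univ x))

/-- Some choice of signs makes the `L²` norm of a sum at least as large as for an orthogonal
family. -/
lemma exists_signs_sum_integral_sq_le (μ : Measure α) [IsFiniteMeasure μ] (s : Finset ι)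
    (g : ι → α → ℂ) (hg : ∀ i, Continuous (g i)) :
    ∃ ε : ι → ℂ, (∀ i, ‖ε i‖ = 1) ∧
      ∑ i ∈ s, ∫ x, ‖g i x‖ ^ 2 ∂μ ≤ ∫ x, ‖∑ i ∈ s, ε i * g i x‖ ^ 2 ∂μ := by
  classical
  induction s using Finset.induction_on with
  | empty => exact ⟨fun _ => 1, by simp, by simp⟩
  | insert a s ha ih =>
    obtain ⟨ε, hε, hle⟩ := ih
    have hS : Continuous fun x => ∑ i ∈ s, ε i * g i x := by fun_prop
    -- By the parallelogram law the two signs of the new term average to the sum of the two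
    -- integrals, so one sign does at least as well.
    have hpar : (∫ x, ‖(∑ i ∈ s, ε i * g i x) + g a x‖ ^ 2 ∂μ) +
        ∫ x, ‖(∑ i ∈ s, ε i * g i x) - g a x‖ ^ 2 ∂μ =
        2 * ((∫ x, ‖∑ i ∈ s, ε i * g i x‖ ^ 2 ∂μ) + ∫ x, ‖g a x‖ ^ 2 ∂μ) := by
      have ha' := hg a
      rw [← integral_add, ← integral_add, ← integral_const_mul]
      · refine integral_congr_ae (Filter.Eventually.of_forall fun x => ?_)
        have := parallelogram_law_with_norm ℂ (∑ i ∈ s, ε i * g i x) (g a x)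
        simp only
        linarith
      all_goals exact Continuous.integrable_of_compactSpace (by fun_prop)
    have hsum : ∀ u : ℂ, ∀ x, ∑ i ∈ insert a s, Function.update ε a u i * g i x =
        (∑ i ∈ s, ε i * g i x) + u * g a x := by
      intro u x
      rw [Finset.sum_insert ha, Function.update_self, add_comm]
      congr 1
      refine Finset.sum_congr rfl fun i hi => ?_
      rw [Function.update_of_ne (ne_of_mem_of_not_mem hi ha)]
    have hnorm : ∀ u : ℂ, ‖u‖ = 1 → ∀ i, ‖Function.update ε a u i‖ = 1 := by
      intro u hu i
      by_cases hi : i = a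
      · subst hi; simpa using hu
      · rw [Function.update_of_ne hi]; exact hε i
    rw [Finset.sum_insert ha]
    rcases le_total (∫ x, ‖(∑ i ∈ s, ε i * g i x) + g a x‖ ^ 2 ∂μ)
      (∫ x, ‖(∑ i ∈ s, ε i * g i x) - g a x‖ ^ 2 ∂μ) with h | h
    · refine ⟨Function.update ε a (-1), hnorm _ (by simp), ?_⟩
      simp only [hsum, neg_one_mul, ← sub_eq_add_neg]
      linarith
    · refine ⟨Function.update ε a 1, hnorm _ (by simp), ?_⟩
      simp only [hsum, one_mul]
      linarith

end Signs

/-! ### Separated sets of complex lines -/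

section ProjectiveSeparation

variable {E : Type*} [NormedAddCommGroup E] [InnerProductSpace ℂ E]

/-- A finite set of unit vectors, any two of which span complex lines at squared chordal distance
at least `t`. -/
structure ProjSeparated (t : ℝ) (S : Finset E) : Prop where
  norm_eq_one : ∀ x ∈ S, ‖x‖ = 1
  le : ∀ x ∈ S, ∀ y ∈ S, x ≠ y → t ≤ 1 - ‖inner ℂ x y‖ ^ 2

lemma norm_inner_le_one_of_unit {x z : E} (hx : ‖x‖ = 1) (hz : ‖z‖ = 1) : ‖inner ℂ x z‖ ≤ 1 := by
  simpa [hx, hz] using norm_inner_le_norm (𝕜 := ℂ) x z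

variable [NormedSpace ℝ E] [FiniteDimensional ℝ E] {t : ℝ} {S : Finset E}

/-- Each `x` is multiplied by a phase making its inner product with `z` nonnegative. Chordal
conditions then become Euclidean ones, distance at most `2 * m * √t` from `z` and mutual distance at
least `√t`, and volume packing applies. -/
lemma ProjSeparated.card_filter_le (hS : ProjSeparated t S) (ht : 0 < t) {z : E} (hz : ‖z‖ = 1)
    {m : ℝ} (hm : 1 ≤ m) :
    ((S.filter fun x => 1 - ‖inner ℂ x z‖ ^ 2 ≤ m * t).card : ℝ) ≤
      (4 * m + 1) ^ Module.finrank ℝ E := by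
  have hsq : 0 < √t := Real.sqrt_pos.2 ht
  have hsqt : √t ^ 2 = t := Real.sq_sqrt ht.le
  choose u hu1 hu using fun x : E => RCLike.exists_norm_eq_mul_self (inner ℂ z x : ℂ)
  have hdist : ∀ x y : E, ‖x‖ = 1 → ‖y‖ = 1 → ‖x - y‖ ^ 2 = 2 - 2 * (inner ℂ x y : ℂ).re := by
    intro x y hx hy
    have := norm_sub_sq (𝕜 := ℂ) x y
    rw [this, hx, hy]
    simp only [RCLike.re_to_complex]
    ring
  have hun : ∀ x : E, ‖x‖ = 1 → ‖u x • x‖ = 1 := fun x hx => by rw [norm_smul, hu1, hx, one_mul]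
  refine (card_le_of_separated_of_mem_closedBall _ (fun x => u x • x) z (R := 2 * m * √t) (δ := √t)
    (by positivity) hsq ?_ ?_).trans (le_of_eq ?_)
  · intro x hx
    rw [Finset.mem_filter] at hx
    have hx1 := hS.norm_eq_one x hx.1
    have hle := norm_inner_le_one_of_unit hx1 hz
    refine (sq_le_sq₀ (norm_nonneg _) (by positivity)).1 ?_
    rw [norm_sub_rev, hdist z _ hz (hun x hx1), inner_smul_right, ← hu x]
    have h1 : (RCLike.ofReal ‖inner ℂ z x‖ : ℂ).re = ‖inner ℂ x z‖ := by
      rw [norm_inner_symm]; simp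
    rw [h1, mul_pow, hsqt]
    have h2 := norm_nonneg (inner ℂ x z)
    have h3 := hx.2
    nlinarith [mul_pos ht (by linarith : 0 < m)]
  · intro x hx y hy hxy
    rw [Finset.mem_filter] at hx hy
    have hx1 := hS.norm_eq_one x hx.1
    have hy1 := hS.norm_eq_one y hy.1
    have hle := norm_inner_le_one_of_unit hx1 hy1
    have hsep := hS.le x hx.1 y hy.1 hxy
    refine (sq_le_sq₀ hsq.le (norm_nonneg _)).1 ?_
    rw [hdist _ _ (hun x hx1) (hun y hy1), hsqt]
    have h1 : (inner ℂ (u x • x) (u y • y) : ℂ).re ≤ ‖inner ℂ x y‖ := by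
      refine (Complex.re_le_norm _).trans (le_of_eq ?_)
      rw [inner_smul_left, inner_smul_right, norm_mul, norm_mul, RCLike.norm_conj, hu1, hu1,
        one_mul, one_mul]
    nlinarith [norm_nonneg (inner ℂ x y)]
  · congr 1
    field_simp
    ring

lemma ProjSeparated.card_le (hS : ProjSeparated t S) (ht : 0 < t) (ht1 : t ≤ 1) :
    (S.card : ℝ) ≤ (4 * (1 / t) + 1) ^ Module.finrank ℝ E := by
  rcases S.eq_empty_or_nonempty with rfl | ⟨z, hz⟩
  · simp only [Finset.card_empty, Nat.cast_zero]; positivity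
  · have h := hS.card_filter_le ht (hS.norm_eq_one z hz) ((one_le_div ht).2 ht1)
    rwa [Finset.filter_true_of_mem] at h
    intro x _
    rw [one_div_mul_cancel ht.ne']
    linarith [sq_nonneg ‖inner ℂ x z‖]

variable (E) in
-- A separated set of maximal cardinality covers, since an uncovered unit vector could be added to
-- it.
lemma exists_projSeparated_covering (ht : 0 < t) (ht1 : t ≤ 1) :
    ∃ S : Finset E, ProjSeparated t S ∧ ∀ z : E, ‖z‖ = 1 → ∃ x ∈ S, 1 - ‖inner ℂ x z‖ ^ 2 < t := by
  classical
  set A : Set ℕ := {k | ∃ S : Finset E, ProjSeparated t S ∧ S.card = k} with hA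
  have hne : A.Nonempty := ⟨0, ∅, ⟨by simp, by simp⟩, rfl⟩
  have hbdd : BddAbove A := by
    obtain ⟨N, hN⟩ := exists_nat_ge ((4 * (1 / t) + 1) ^ Module.finrank ℝ E)
    refine ⟨N, ?_⟩
    rintro _ ⟨S, hS, rfl⟩
    exact_mod_cast (hS.card_le ht ht1).trans hN
  obtain ⟨S, hS, hcard⟩ := Nat.sSup_mem hne hbdd
  refine ⟨S, hS, fun z hz => ?_⟩
  by_contra! hcon
  have hzS : z ∉ S := by
    intro h
    have := hcon z h
    rw [inner_self_eq_norm_sq_to_K, hz] at this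
    norm_num at this
    linarith
  have hins : ProjSeparated t (insert z S) := by
    refine ⟨fun x hx => ?_, fun x hx y hy hxy => ?_⟩
    · rcases Finset.mem_insert.1 hx with rfl | hx
      exacts [hz, hS.norm_eq_one x hx]
    · rcases Finset.mem_insert.1 hx with rfl | hx' <;>
        rcases Finset.mem_insert.1 hy with rfl | hy'
      · exact absurd rfl hxy
      · rw [norm_inner_symm]; exact hcon y hy'
      · exact hcon x hx'
      · exact hS.le x hx' y hy' hxy
  have := le_csSup hbdd ⟨insert z S, hins, rfl⟩
  rw [Finset.card_insert_of_notMem hzS, hcard] at this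
  omega

lemma summable_pow_mul_exp_neg_half (D : ℕ) :
    Summable fun k : ℕ => (4 * (2 * ((k : ℝ) + 1)) + 1) ^ D * Real.exp (-(k / 2)) := by
  have h1 := (summable_nat_add_iff 1).2
    (Real.summable_pow_mul_exp_neg_nat_mul D (r := 1 / 2) (by norm_num))
  refine Summable.of_nonneg_of_le (fun k => by positivity) (fun k => ?_)
    (h1.mul_left (9 ^ D * Real.exp (1 / 2)))
  have h2 : Real.exp (-(k / 2)) = Real.exp (1 / 2) * Real.exp (-(1 / 2) * ((k + 1 : ℕ) : ℝ)) := by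
    rw [← Real.exp_add]; congr 1; push_cast; ring
  have h3 : (4 * (2 * ((k : ℝ) + 1)) + 1) ^ D ≤ 9 ^ D * ((k + 1 : ℕ) : ℝ) ^ D := by
    rw [← mul_pow]
    push_cast
    gcongr
    have : (0 : ℝ) ≤ k := Nat.cast_nonneg k
    linarith
  rw [h2]
  calc _ ≤ 9 ^ D * ((k + 1 : ℕ) : ℝ) ^ D *
        (Real.exp (1 / 2) * Real.exp (-(1 / 2) * ((k + 1 : ℕ) : ℝ))) := by gcongr
    _ = _ := by ring

/-- For a separated set at scale `n⁻¹ᐟ²`, the peaking monomials of degree `n` have a bounded sum. -/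
lemma ProjSeparated.sum_norm_inner_pow_le {n : ℕ} (hn : 1 ≤ n)
    (hS : ProjSeparated (1 / (2 * n)) S) {z : E} (hz : ‖z‖ = 1) :
    ∑ x ∈ S, ‖inner ℂ x z‖ ^ n ≤
      ∑' k : ℕ, (4 * (2 * ((k : ℝ) + 1)) + 1) ^ Module.finrank ℝ E * Real.exp (-(k / 2)) := by
  have hn0 : (0 : ℝ) < n := by exact_mod_cast hn
  -- Points are sorted into shells around `z`. On shell `k` each term is at most `exp (-k / 2)`,
  -- while the number of points grows only polynomially in `k`.
  set κ : E → ℕ := fun x => ⌊n * (1 - ‖inner ℂ x z‖ ^ 2)⌋₊ with hκ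
  have hnonneg : ∀ x ∈ S, 0 ≤ n * (1 - ‖inner ℂ x z‖ ^ 2) := fun x hx => by
    have := norm_inner_le_one_of_unit (hS.norm_eq_one x hx) hz
    have : ‖inner ℂ x z‖ ^ 2 ≤ 1 := pow_le_one₀ (norm_nonneg _) this
    exact mul_nonneg hn0.le (by linarith)
  have hmaps : ∀ x ∈ S, κ x ∈ Finset.range (n + 1) := by
    intro x hx
    rw [Finset.mem_range, Nat.lt_succ_iff]
    refine Nat.floor_le_of_le ?_
    nlinarith [sq_nonneg ‖inner ℂ x z‖]
  have hterm : ∀ x ∈ S, ‖inner ℂ x z‖ ^ n ≤ Real.exp (-(κ x / 2)) := by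
    intro x hx
    have h1 : (κ x : ℝ) ≤ n * (1 - ‖inner ℂ x z‖ ^ 2) := Nat.floor_le (hnonneg x hx)
    have h2 : ‖inner ℂ x z‖ ^ 2 ≤ Real.exp (-(κ x / n)) := by
      have h3 : (κ x : ℝ) / n ≤ 1 - ‖inner ℂ x z‖ ^ 2 := by
        rw [div_le_iff₀ hn0]; linarith
      linarith [Real.add_one_le_exp (-(κ x / n : ℝ))]
    refine (sq_le_sq₀ (by positivity) (Real.exp_pos _).le).1 ?_
    calc (‖inner ℂ x z‖ ^ n) ^ 2 = (‖inner ℂ x z‖ ^ 2) ^ n := by rw [← pow_mul, ← pow_mul, mul_comm]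
      _ ≤ Real.exp (-(κ x / n)) ^ n := by gcongr
      _ = Real.exp (-(κ x / 2)) ^ 2 := by
        rw [← Real.exp_nat_mul, ← Real.exp_nat_mul]
        congr 1
        push_cast
        field_simp
  rw [← Finset.sum_fiberwise_of_maps_to hmaps]
  refine le_trans (Finset.sum_le_sum fun k _ => ?_)
    ((summable_pow_mul_exp_neg_half (Module.finrank ℝ E)).sum_le_tsum (Finset.range (n + 1))
      fun k _ => by positivity)
  calc ∑ x ∈ S with κ x = k, ‖inner ℂ x z‖ ^ n
      ≤ ∑ x ∈ S with κ x = k, Real.exp (-(k / 2)) := by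
        refine Finset.sum_le_sum fun x hx => ?_
        rw [Finset.mem_filter] at hx
        rw [← hx.2]
        exact hterm x hx.1
    _ = ((S.filter fun x => κ x = k).card : ℝ) * Real.exp (-(k / 2)) := by
        rw [Finset.sum_const, nsmul_eq_mul]
    _ ≤ _ := by
        gcongr
        refine le_trans ?_ (hS.card_filter_le (by positivity) hz (m := 2 * ((k : ℝ) + 1))
          (by have : (0 : ℝ) ≤ k := Nat.cast_nonneg k
              linarith))
        gcongr with x hx
        intro hxk
        have := Nat.lt_floor_add_one (n * (1 - ‖inner ℂ x z‖ ^ 2))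
        rw [show ⌊n * (1 - ‖inner ℂ x z‖ ^ 2)⌋₊ = k from hxk] at this
        rw [show 2 * ((k : ℝ) + 1) * (1 / (2 * n)) = (k + 1) / n by field_simp,
          le_div_iff₀ hn0]
        linarith

end ProjectiveSeparation

/-! ### Bounded homogeneous polynomials with large `L²` mean -/

lemma isProbabilityMeasure_sphereMeasure {d : ℕ} (hd : 1 ≤ d) :
    IsProbabilityMeasure (sphereMeasure d) := by
  have : NeZero d := ⟨by omega⟩
  refine ⟨?_⟩
  rw [sphereMeasure, Measure.smul_apply, smul_eq_mul]
  refine ENNReal.inv_mul_cancel ?_ (measure_ne_top _ _)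
  rw [Measure.measure_univ_ne_zero]
  exact Measure.toSphere_ne_zero _

/-- Homogeneous polynomials of every degree, uniformly bounded on the sphere of `ℂ^d` and with
`L²` means bounded below. -/
lemma exists_bounded_homogeneous {d : ℕ} (hd : 1 ≤ d) :
    ∃ C : ℝ, 1 ≤ C ∧ ∀ n : ℕ, ∃ W : Cd d → ℂ, Differentiable ℂ W ∧
      (∀ (c : ℂ) (z : Cd d), W (c • z) = c ^ n * W z) ∧ (∀ z : Cd d, ‖z‖ = 1 → ‖W z‖ ≤ C) ∧
      1 / 2 ≤ ∫ ζ : Metric.sphere (0 : Cd d) 1, ‖W ζ‖ ^ 2 ∂(sphereMeasure d) := by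
  have := isProbabilityMeasure_sphereMeasure hd
  refine ⟨_, le_max_left 1 (∑' k : ℕ, (4 * (2 * ((k : ℝ) + 1)) + 1) ^ Module.finrank ℝ (Cd d) *
    Real.exp (-(k / 2))), fun n => ?_⟩
  rcases Nat.eq_zero_or_pos n with rfl | hn
  · refine ⟨fun _ => 1, differentiable_const _, by simp, fun z _ => ?_, ?_⟩
    · rw [norm_one]; exact le_max_left _ _
    · simp; norm_num
  have hn0 : (1 : ℝ) ≤ n := by exact_mod_cast hn
  have ht1 : 1 / (2 * (n : ℝ)) ≤ 1 := by
    rw [div_le_one (by positivity)]; linarith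
  obtain ⟨S, hS, hcov⟩ := exists_projSeparated_covering (Cd d) (t := 1 / (2 * (n : ℝ)))
    (by positivity) ht1
  obtain ⟨ε, hε, hint⟩ := exists_signs_sum_integral_sq_le (sphereMeasure d) S
    (fun x (ζ : Metric.sphere (0 : Cd d) 1) => (inner ℂ x (ζ : Cd d) : ℂ) ^ n) (fun x => by fun_prop)
  refine ⟨fun z => ∑ x ∈ S, ε x * (inner ℂ x z : ℂ) ^ n, ?_, ?_, ?_, le_trans ?_ hint⟩
  · have hd : ∀ x : Cd d, Differentiable ℂ fun z : Cd d => (inner ℂ x z : ℂ) := fun x =>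
      (innerSL ℂ x).differentiable
    exact Differentiable.fun_sum fun x _ => ((hd x).pow n).const_mul _
  · intro c z
    simp only [inner_smul_right, mul_pow, Finset.mul_sum]
    exact Finset.sum_congr rfl fun x _ => by ring
  · intro z hz
    refine (norm_sum_le _ _).trans (le_trans (le_of_eq ?_)
      ((hS.sum_norm_inner_pow_le hn hz).trans (le_max_right _ _)))
    exact Finset.sum_congr rfl fun x _ => by rw [norm_mul, hε, one_mul, norm_pow]
  · rw [← integral_finsetSum _ fun x _ => Continuous.integrable_of_compactSpace (by fun_prop)]
    have h1 : ∫ _ζ : Metric.sphere (0 : Cd d) 1, (1 / 2 : ℝ) ∂(sphereMeasure d) = 1 / 2 := by simp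
    rw [← h1]
    refine integral_mono (integrable_const _)
      (Continuous.integrable_of_compactSpace (by fun_prop)) fun ζ => ?_
    have hζ : ‖(ζ : Cd d)‖ = 1 := by simp
    obtain ⟨x, hx, hlt⟩ := hcov ζ hζ
    refine le_trans ?_ (Finset.single_le_sum (f := fun x => ‖(inner ℂ x (ζ : Cd d) : ℂ) ^ n‖ ^ 2)
      (fun x _ => by positivity) hx)
    -- The scale `1 / (2 * n)` is chosen so that Bernoulli's inequality leaves `1 / 2` after taking
    -- the `n`-th power.
    have h2 : 1 - 1 / (2 * (n : ℝ)) ≤ ‖inner ℂ x (ζ : Cd d)‖ ^ 2 := by linarith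
    calc (1 / 2 : ℝ) = 1 + n * (-(1 / (2 * (n : ℝ)))) := by field_simp; ring
      _ ≤ (1 + -(1 / (2 * (n : ℝ)))) ^ n := one_add_mul_le_pow (by linarith) n
      _ ≤ (‖inner ℂ x (ζ : Cd d)‖ ^ 2) ^ n :=
        pow_le_pow_left₀ (by linarith) (by linarith) n
      _ = ‖(inner ℂ x (ζ : Cd d) : ℂ) ^ n‖ ^ 2 := by rw [norm_pow, ← pow_mul, ← pow_mul, mul_comm]

/-! ### Rotation invariance and orthogonality of degrees -/

section Rotation

open Pointwise

/-- The rotation of the unit sphere of `ℂ^d` by a complex number of modulus one. -/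
def sphereRotation {d : ℕ} (c : ℂ) (hc : ‖c‖ = 1) (ζ : Metric.sphere (0 : Cd d) 1) :
    Metric.sphere (0 : Cd d) 1 :=
  ⟨c • (ζ : Cd d), by simp [norm_smul, hc]⟩

lemma continuous_sphereRotation {d : ℕ} (c : ℂ) (hc : ‖c‖ = 1) :
    Continuous (sphereRotation (d := d) c hc) :=
  Continuous.subtype_mk (by fun_prop) _

lemma volume_preimage_smul_of_norm_eq_one {d : ℕ} {c : ℂ} (hc : ‖c‖ = 1) (s : Set (Cd d))
    (hs : NullMeasurableSet s volume) :
    volume ((fun z : Cd d => c • z) ⁻¹' s) = volume s := by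
  have hc0 : c ≠ 0 := fun h => by simp [h] at hc
  let e : Cd d ≃ₗᵢ[ℝ] Cd d :=
    { (LinearEquiv.smulOfNeZero ℂ (Cd d) c hc0).restrictScalars ℝ with
      norm_map' := fun x => by
        change ‖c • x‖ = ‖x‖
        rw [norm_smul, hc, one_mul] }
  exact e.measurePreserving.measure_preimage hs

/-- The surface measure of a set is defined by the volume of the cone over it, and the rotation
extends to a linear isometry carrying cones to cones. -/
lemma measurePreserving_sphereRotation {d : ℕ} (c : ℂ) (hc : ‖c‖ = 1) :
    MeasurePreserving (sphereRotation (d := d) c hc) (sphereMeasure d) (sphereMeasure d) := by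
  have hc0 : c ≠ 0 := fun h => by simp [h] at hc
  have hmeas := (continuous_sphereRotation (d := d) c hc).measurable
  refine ⟨hmeas, ?_⟩
  ext s hs
  rw [Measure.map_apply hmeas hs, sphereMeasure, Measure.smul_apply, Measure.smul_apply,
    Measure.toSphere_apply' _ hs, Measure.toSphere_apply' _ (hmeas hs)]
  congr 2
  have hpre : Ioo (0 : ℝ) 1 • (Subtype.val '' (sphereRotation (d := d) c hc ⁻¹' s)) =
      (fun z : Cd d => c • z) ⁻¹' (Ioo (0 : ℝ) 1 • (Subtype.val '' s)) := by
    ext z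
    simp only [mem_smul, mem_preimage, mem_image]
    constructor
    · rintro ⟨t, ht, _, ⟨ζ, hζ, rfl⟩, rfl⟩
      exact ⟨t, ht, _, ⟨_, hζ, rfl⟩, smul_comm _ _ _⟩
    · rintro ⟨t, ht, _, ⟨ζ, hζ, rfl⟩, h⟩
      refine ⟨t, ht, c⁻¹ • (ζ : Cd d), ⟨⟨c⁻¹ • (ζ : Cd d), by simp [norm_smul, hc]⟩, ?_, rfl⟩, ?_⟩
      · convert hζ
        ext1
        simp [sphereRotation, smul_smul, hc0]
      · rw [smul_comm, h, smul_smul, inv_mul_cancel₀ hc0, one_smul]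
  rw [hpre]
  refine volume_preimage_smul_of_norm_eq_one hc _ (MeasurableSet.nullMeasurableSet ?_)
  have h1 : Ioo (0 : ℝ) 1 • (Subtype.val '' s : Set (Cd d)) =
      Subtype.val '' (homeomorphUnitSphereProd (Cd d) ⁻¹'
        (s ×ˢ Iio (⟨1, mem_Ioi.2 one_pos⟩ : Ioi (0 : ℝ)))) := by
    rw [← image2_smul, image2_image_right, ← Homeomorph.image_symm, image_image,
      show Ioo (0 : ℝ) 1 = _ from (image_subtype_val_Ioi_Iio (⟨1, mem_Ioi.2 one_pos⟩ : Ioi (0 : ℝ))).symm,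
      image2_image_left, image2_swap, ← image_prod]
    rfl
  rw [h1]
  exact (MeasurableEmbedding.subtype_coe (measurableSet_singleton _).compl).measurableSet_image.2
    ((homeomorphUnitSphereProd (Cd d)).continuous.measurable (hs.prod measurableSet_Iio))

/-- Homogeneous functions of different degrees are orthogonal on the sphere. -/
lemma integral_mul_conj_eq_zero_of_homogeneous {d m n : ℕ} (hmn : n ≠ m) {V W : Cd d → ℂ}
    (hV : Continuous V) (hW : Continuous W) (hVh : ∀ (c : ℂ) (z : Cd d), V (c • z) = c ^ n * V z)
    (hWh : ∀ (c : ℂ) (z : Cd d), W (c • z) = c ^ m * W z) :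
    ∫ ζ : Metric.sphere (0 : Cd d) 1, V ζ * (starRingEnd ℂ) (W ζ) ∂(sphereMeasure d) = 0 := by
  -- The angle satisfies `c ^ (n - m) = -1`, so rotating by `c` changes the sign of the integrand.
  set x : ℝ := Real.pi / ((n : ℝ) - m) with hx
  set c : ℂ := Complex.exp (x * Complex.I) with hcdef
  have hc : ‖c‖ = 1 := Complex.norm_exp_ofReal_mul_I x
  have hnm : (n : ℝ) - m ≠ 0 := sub_ne_zero.2 (by exact_mod_cast hmn)
  have hcc : c ^ n * (starRingEnd ℂ) c ^ m = -1 := by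
    rw [hcdef, ← Complex.exp_conj, ← Complex.exp_nat_mul, ← Complex.exp_nat_mul, ← Complex.exp_add,
      ← Complex.exp_pi_mul_I]
    congr 1
    have h1 : (Real.pi : ℂ) = ((n : ℂ) - m) * x := by
      rw [hx]
      push_cast
      have : (n : ℂ) - m ≠ 0 := by exact_mod_cast hnm
      field_simp
    rw [h1, map_mul, Complex.conj_ofReal, Complex.conj_I]
    ring
  have hmp := measurePreserving_sphereRotation (d := d) c hc
  have hcont : Continuous fun ζ : Metric.sphere (0 : Cd d) 1 =>
      V ζ * (starRingEnd ℂ) (W ζ) := by fun_prop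
  have h1 : ∫ ζ : Metric.sphere (0 : Cd d) 1, V ζ * (starRingEnd ℂ) (W ζ) ∂(sphereMeasure d) =
      ∫ ζ : Metric.sphere (0 : Cd d) 1, -(V ζ * (starRingEnd ℂ) (W ζ)) ∂(sphereMeasure d) := by
    conv_lhs => rw [← hmp.map_eq, integral_map hmp.measurable.aemeasurable
      hcont.measurable.aestronglyMeasurable]
    refine integral_congr_ae (Filter.Eventually.of_forall fun ζ => ?_)
    simp only [sphereRotation, hVh, hWh, map_mul, map_pow]
    linear_combination (V ζ * (starRingEnd ℂ) (W ζ)) * hcc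
  rw [integral_neg] at h1
  exact self_eq_neg.1 h1

end Rotation

/-! ### Lower bounds for `L²` and `L^q` means -/

section OrthogonalSeries

variable {α : Type*} [TopologicalSpace α] [CompactSpace α] [MeasurableSpace α]
  [OpensMeasurableSpace α]

/-- Bessel's inequality for one term of a uniformly convergent series of orthogonal functions. -/
lemma sq_mul_integral_sq_le_of_orthogonal {μ : Measure α} [IsFiniteMeasure μ] {V : ℕ → α → ℂ}
    (hV : ∀ k, Continuous (V k)) {C : ℝ} (hC : ∀ k x, ‖V k x‖ ≤ C)
    (horth : ∀ j k, j ≠ k → ∫ x, V j x * (starRingEnd ℂ) (V k x) ∂μ = 0) {b : ℕ → ℝ}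
    (hb : ∀ k, 0 ≤ b k) (hsum : Summable b) (k : ℕ) :
    b k ^ 2 * ∫ x, ‖V k x‖ ^ 2 ∂μ ≤ ∫ x, ‖∑' j, (b j : ℂ) * V j x‖ ^ 2 ∂μ := by
  have hterm : ∀ j x, ‖(b j : ℂ) * V j x‖ ≤ b j * C := fun j x => by
    rw [norm_mul, Complex.norm_real, Real.norm_of_nonneg (hb j)]
    exact mul_le_mul_of_nonneg_left (hC j x) (hb j)
  have hF : Continuous fun x => ∑' j, (b j : ℂ) * V j x :=
    continuous_tsum (fun j => by have := hV j; fun_prop) (hsum.mul_right C) hterm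
  set F : α → ℂ := fun x => ∑' j, (b j : ℂ) * V j x with hFdef
  have hVk := hV k
  have hFV : ∫ x, F x * (starRingEnd ℂ) (V k x) ∂μ = ((b k * ∫ x, ‖V k x‖ ^ 2 ∂μ : ℝ) : ℂ) := by
    have hint : ∀ j, Integrable (fun x => (b j : ℂ) * V j x * (starRingEnd ℂ) (V k x)) μ := fun j =>
      Continuous.integrable_of_compactSpace (by have := hV j; fun_prop)
    have hnorm : ∀ j x, ‖(b j : ℂ) * V j x * (starRingEnd ℂ) (V k x)‖ ≤ b j * C * C := by
      intro j x
      rw [norm_mul, RCLike.norm_conj]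
      exact mul_le_mul (hterm j x) (hC k x) (norm_nonneg _) ((norm_nonneg _).trans (hterm j x))
    have hs : Summable fun j => ∫ x, ‖(b j : ℂ) * V j x * (starRingEnd ℂ) (V k x)‖ ∂μ := by
      refine Summable.of_nonneg_of_le (fun j => integral_nonneg fun x => norm_nonneg _)
        (fun j => ?_) (((hsum.mul_right C).mul_right C).mul_right (μ.real univ))
      refine (integral_mono (hint j).norm (integrable_const _) (hnorm j)).trans (le_of_eq ?_)
      rw [integral_const, smul_eq_mul, mul_comm]
    have h1 := hasSum_integral_of_summable_integral_norm hint hs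
    have h2 : ∀ x, ∑' j, (b j : ℂ) * V j x * (starRingEnd ℂ) (V k x) =
        F x * (starRingEnd ℂ) (V k x) := fun x => tsum_mul_right
    simp only [h2] at h1
    rw [← h1.tsum_eq, tsum_eq_single k]
    · rw [Complex.ofReal_mul, ← integral_complex_ofReal, ← integral_const_mul]
      refine integral_congr_ae (Filter.Eventually.of_forall fun x => ?_)
      simp only [mul_assoc, Complex.mul_conj', Complex.ofReal_pow]
    · intro j hj
      simp only [mul_assoc]
      rw [integral_const_mul, horth j k hj, mul_zero]
  -- This expands `‖F x - b k * V k x‖ ^ 2 ≥ 0`; integrating it with `hFV` gives Bessel's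
  -- inequality.
  have hpt : ∀ x, 2 * b k * (F x * (starRingEnd ℂ) (V k x)).re - b k ^ 2 * ‖V k x‖ ^ 2 ≤
      ‖F x‖ ^ 2 := by
    intro x
    have h2 := sq_nonneg ((F x).re - b k * (V k x).re)
    have h3 := sq_nonneg ((F x).im - b k * (V k x).im)
    rw [← Complex.normSq_eq_norm_sq, ← Complex.normSq_eq_norm_sq, Complex.normSq_apply,
      Complex.normSq_apply, Complex.mul_re, Complex.conj_re, Complex.conj_im]
    nlinarith
  have hi1 : Integrable (fun x => F x * (starRingEnd ℂ) (V k x)) μ :=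
    Continuous.integrable_of_compactSpace (by fun_prop)
  have hi2 : Integrable (fun x => ‖V k x‖ ^ 2) μ :=
    Continuous.integrable_of_compactSpace (by fun_prop)
  have hre : Integrable (fun x => (F x * (starRingEnd ℂ) (V k x)).re) μ :=
    Continuous.integrable_of_compactSpace (by fun_prop)
  have hmain := integral_mono ((hre.const_mul (2 * b k)).sub (hi2.const_mul (b k ^ 2)))
    (Continuous.integrable_of_compactSpace (by fun_prop)) hpt
  have hre' : ∫ x, (F x * (starRingEnd ℂ) (V k x)).re ∂μ = b k * ∫ x, ‖V k x‖ ^ 2 ∂μ := by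
    have := integral_re hi1
    simp only [RCLike.re_to_complex] at this
    rw [this, hFV, Complex.ofReal_re]
  simp only [Pi.sub_apply] at hmain
  rw [integral_sub (hre.const_mul _) (hi2.const_mul _), integral_const_mul, integral_const_mul,
    hre'] at hmain
  refine le_trans (le_of_eq ?_) hmain
  ring

/-- The `L^q` means of a bounded function with a large `L²` mean are comparable to its bound. -/
lemma rpow_integral_mean_bounds {μ : Measure α} [IsProbabilityMeasure μ] {g : α → ℝ}
    (hg : Continuous g) (hg0 : ∀ x, 0 ≤ g x) {A θ q : ℝ} (hA : 0 < A) (hgA : ∀ x, g x ≤ A)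
    (hθ : 0 < θ) (hq : 0 < q) (h2 : θ * A ^ 2 ≤ ∫ x, g x ^ 2 ∂μ) :
    ((θ / 2) ^ (q / 2) * (θ / 2)) ^ (1 / q) * A ≤ (∫ x, g x ^ q ∂μ) ^ (1 / q) ∧
      (∫ x, g x ^ q ∂μ) ^ (1 / q) ≤ A := by
  have hgq : Continuous fun x => g x ^ q := hg.rpow_const fun x => Or.inr hq.le
  have hiq : Integrable (fun x => g x ^ q) μ := Continuous.integrable_of_compactSpace hgq
  have hi2 : Integrable (fun x => g x ^ 2) μ := Continuous.integrable_of_compactSpace (by fun_prop)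
  have hAq : (A ^ q) ^ (1 / q) = A := by
    rw [← Real.rpow_mul hA.le, mul_one_div_cancel hq.ne', Real.rpow_one]
  have hAq0 : 0 < A ^ q := Real.rpow_pos_of_pos hA q
  set K : ℝ := (θ / 2) ^ (q / 2) with hK
  have hK0 : 0 < K := Real.rpow_pos_of_pos (by positivity) _
  have hint0 : 0 ≤ ∫ x, g x ^ q ∂μ := integral_nonneg fun x => Real.rpow_nonneg (hg0 x) q
  constructor
  -- The left side is nonpositive where `g ^ 2 ≤ θ / 2 * A ^ 2` and at most `K * A ^ q` elsewhere,
  -- so integrating replaces estimating the measure of the set where `g` is large.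
  · have hpt : ∀ x, K * A ^ q * (g x ^ 2 / A ^ 2 - θ / 2) ≤ g x ^ q := by
      intro x
      have hle : g x ^ 2 / A ^ 2 ≤ 1 := by
        rw [div_le_one (by positivity)]
        exact pow_le_pow_left₀ (hg0 x) (hgA x) 2
      rcases le_or_gt (g x ^ 2 / A ^ 2) (θ / 2) with h | h
      · exact (mul_nonpos_of_nonneg_of_nonpos (by positivity) (by linarith)).trans
          (Real.rpow_nonneg (hg0 x) q)
      · have hsq : (g x ^ 2 / A ^ 2) ^ (q / 2) * A ^ q = g x ^ q := by
          rw [← div_pow, ← Real.rpow_natCast, ← Real.rpow_mul (div_nonneg (hg0 x) hA.le),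
            show ((2 : ℕ) : ℝ) * (q / 2) = q by push_cast; ring, Real.div_rpow (hg0 x) hA.le,
            div_mul_cancel₀ _ hAq0.ne']
        rw [← hsq]
        calc K * A ^ q * (g x ^ 2 / A ^ 2 - θ / 2) ≤ K * A ^ q * 1 := by
              gcongr; linarith
          _ ≤ _ := by
              rw [mul_one]
              exact mul_le_mul_of_nonneg_right
                (Real.rpow_le_rpow (by positivity) h.le (by positivity)) hAq0.le
    have hmain := integral_mono (((hi2.div_const (A ^ 2)).sub (integrable_const (θ / 2))).const_mul
      (K * A ^ q)) hiq hpt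
    simp only [Pi.sub_apply] at hmain
    rw [integral_const_mul, integral_sub (hi2.div_const _) (integrable_const _), integral_div,
      integral_const, probReal_univ, one_smul] at hmain
    have h3 : θ / 2 ≤ (∫ x, g x ^ 2 ∂μ) / A ^ 2 - θ / 2 := by
      have : θ ≤ (∫ x, g x ^ 2 ∂μ) / A ^ 2 := (le_div_iff₀ (by positivity)).2 h2
      linarith
    have h4 : K * (θ / 2) * A ^ q ≤ ∫ x, g x ^ q ∂μ := by
      refine le_trans (le_of_eq (by ring)) ((mul_le_mul_of_nonneg_left h3
        (by positivity : 0 ≤ K * A ^ q)).trans hmain)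
    calc (K * (θ / 2)) ^ (1 / q) * A = (K * (θ / 2) * A ^ q) ^ (1 / q) := by
          rw [Real.mul_rpow (by positivity) hAq0.le, hAq]
      _ ≤ _ := Real.rpow_le_rpow (by positivity) h4 (by positivity)
  · have h5 : ∫ x, g x ^ q ∂μ ≤ A ^ q := by
      refine (integral_mono hiq (integrable_const (A ^ q)) fun x =>
        Real.rpow_le_rpow (hg0 x) (hgA x) hq.le).trans (le_of_eq ?_)
      simp
    exact (Real.rpow_le_rpow hint0 h5 (by positivity)).trans_eq hAq

end OrthogonalSeries

/-! ### Holomorphy of series of homogeneous polynomials -/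

section Homogeneous

variable {E : Type*} [NormedAddCommGroup E] [NormedSpace ℂ E]

lemma exists_unit_smul_norm [Nontrivial E] (z : E) : ∃ u : E, ‖u‖ = 1 ∧ z = (‖z‖ : ℂ) • u := by
  by_cases hz : z = 0
  · obtain ⟨u, hu⟩ := exists_norm_eq E zero_le_one
    exact ⟨u, hu, by simp [hz]⟩
  · have hz' : (‖z‖ : ℂ) ≠ 0 := by simpa using hz
    refine ⟨(‖z‖ : ℂ)⁻¹ • z, ?_, ?_⟩
    · rw [norm_smul, norm_inv, Complex.norm_real, norm_norm, inv_mul_cancel₀ (norm_ne_zero_iff.2 hz)]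
    · rw [smul_smul, mul_inv_cancel₀ hz', one_smul]

lemma norm_le_of_homogeneous [Nontrivial E] {W : E → ℂ} {n : ℕ} {C : ℝ}
    (hh : ∀ (c : ℂ) (z : E), W (c • z) = c ^ n * W z) (hC : ∀ z, ‖z‖ = 1 → ‖W z‖ ≤ C) (z : E) :
    ‖W z‖ ≤ C * ‖z‖ ^ n := by
  obtain ⟨u, hu, hz⟩ := exists_unit_smul_norm z
  conv_lhs => rw [hz, hh, norm_mul, norm_pow, Complex.norm_real, norm_norm, mul_comm]
  exact mul_le_mul_of_nonneg_right (hC u hu) (by positivity)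

/-- Cauchy's estimate for the derivative of a holomorphic function of several variables. -/
lemma norm_fderiv_le_of_forall_norm_le {W : E → ℂ} (hW : Differentiable ℂ W) {z : E} {δ M : ℝ}
    (hδ : 0 < δ) (hM : ∀ y, ‖y - z‖ ≤ δ → ‖W y‖ ≤ M) : ‖fderiv ℂ W z‖ ≤ M / δ := by
  have hM0 : 0 ≤ M := (norm_nonneg _).trans (hM z (by simpa using hδ.le))
  refine ContinuousLinearMap.opNorm_le_bound _ (by positivity) fun v => ?_
  by_cases hv : v = 0
  · simp [hv]
  have hv0 : 0 < ‖v‖ := norm_pos_iff.2 hv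
  have hline : Differentiable ℂ fun t : ℂ => z + t • v := by fun_prop
  have hd : HasDerivAt (fun t : ℂ => W (z + t • v)) (fderiv ℂ W z v) 0 := by
    have h1 : HasDerivAt (fun t : ℂ => z + t • v) v 0 := by
      simpa using ((hasDerivAt_id (0 : ℂ)).smul_const v).const_add z
    have h2 : HasFDerivAt W (fderiv ℂ W z) (z + (0 : ℂ) • v) := by
      simpa using (hW z).hasFDerivAt
    exact h2.comp_hasDerivAt 0 h1
  -- One-variable Cauchy estimate on the complex line through `z` in direction `v`.
  have hle := Complex.norm_deriv_le_of_forall_mem_sphere_norm_le (c := 0) (R := δ / ‖v‖) (C := M)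
    (by positivity) (hW.comp hline).diffContOnCl fun t ht => ?_
  · rw [Function.comp_def, hd.deriv] at hle
    refine hle.trans (le_of_eq ?_)
    field_simp
  · refine hM _ ?_
    rw [mem_sphere_zero_iff_norm] at ht
    rw [add_sub_cancel_left, norm_smul, ht, div_mul_cancel₀ _ hv0.ne']

/-- A series of homogeneous polynomials dominated by a power series converging on `[0, 1)` is
holomorphic on the unit ball. -/
lemma differentiableOn_tsum_homogeneous [Nontrivial E] {W : ℕ → E → ℂ} {n : ℕ → ℕ} {C : ℝ}
    (hW : ∀ k, Differentiable ℂ (W k)) (hh : ∀ k (c : ℂ) (z : E), W k (c • z) = c ^ n k * W k z)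
    (hC : ∀ k z, ‖z‖ = 1 → ‖W k z‖ ≤ C) {a : ℕ → ℝ} (ha : ∀ k, 0 ≤ a k)
    (hsum : ∀ r ∈ Ico (0 : ℝ) 1, Summable fun k => a k * r ^ n k) :
    DifferentiableOn ℂ (fun z => ∑' k, (a k : ℂ) * W k z) (Metric.ball 0 1) := by
  intro z₀ hz₀
  rw [mem_ball_zero_iff] at hz₀
  obtain ⟨ρ, hρ0, hρ1⟩ := exists_between hz₀
  have hρpos : 0 < ρ := (norm_nonneg _).trans_lt hρ0
  set δ : ℝ := (1 - ρ) / 2 with hδ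
  have hδ0 : 0 < δ := by rw [hδ]; linarith
  have hR : ρ + δ ∈ Ico (0 : ℝ) 1 := ⟨by positivity, by rw [hδ]; linarith⟩
  obtain ⟨u₀, hu₀⟩ := exists_norm_eq E zero_le_one
  have hC0 : 0 ≤ C := (norm_nonneg _).trans (hC 0 u₀ hu₀)
  have hbound : ∀ k, ∀ z ∈ Metric.ball (0 : E) ρ,
      ‖(a k : ℂ) • fderiv ℂ (W k) z‖ ≤ C / δ * (a k * (ρ + δ) ^ n k) := by
    intro k z hz
    rw [mem_ball_zero_iff] at hz
    rw [norm_smul, Complex.norm_real, Real.norm_of_nonneg (ha k)]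
    have h1 : ‖fderiv ℂ (W k) z‖ ≤ C * (ρ + δ) ^ n k / δ := by
      refine norm_fderiv_le_of_forall_norm_le (hW k) hδ0 fun y hy => ?_
      refine (norm_le_of_homogeneous (hh k) (hC k) y).trans ?_
      have : ‖y‖ ≤ ρ + δ := by
        have := norm_le_norm_add_norm_sub z y
        rw [norm_sub_rev] at this
        linarith
      gcongr
    calc a k * ‖fderiv ℂ (W k) z‖ ≤ a k * (C * (ρ + δ) ^ n k / δ) :=
          mul_le_mul_of_nonneg_left h1 (ha k)
      _ = _ := by ring
  have hs0 : Summable fun k => (a k : ℂ) * W k z₀ := by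
    refine Summable.of_norm_bounded ((hsum ‖z₀‖ ⟨norm_nonneg _, hz₀⟩).mul_left C) fun k => ?_
    rw [norm_mul, Complex.norm_real, Real.norm_of_nonneg (ha k)]
    calc a k * ‖W k z₀‖ ≤ a k * (C * ‖z₀‖ ^ n k) :=
          mul_le_mul_of_nonneg_left (norm_le_of_homogeneous (hh k) (hC k) z₀) (ha k)
      _ = _ := by ring
  have hmem : z₀ ∈ Metric.ball (0 : E) ρ := mem_ball_zero_iff.2 hρ0
  exact (hasFDerivAt_tsum_of_isPreconnected ((hsum _ hR).mul_left (C / δ)) Metric.isOpen_ball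
    (convex_ball _ _).isPreconnected (fun k z _ => ((hW k z).hasFDerivAt.const_mul (a k : ℂ)))
    hbound hmem hs0 hmem).differentiableAt.differentiableWithinAt

end Homogeneous

/-! ### Comparison of all integral means, and conclusion -/

lemma integralMean_bounds {d : ℕ} (hd : 1 ≤ d) {p : ℝ≥0∞} (hp : 0 < p) {θ : ℝ} (hθ : 0 < θ) :
    ∃ κ : ℝ, 0 < κ ∧ ∀ (f : Cd d → ℂ) (r A : ℝ), 0 ≤ r → 0 < A →
      (Continuous fun ζ : Metric.sphere (0 : Cd d) 1 => f ((r : ℂ) • (ζ : Cd d))) →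
      (∀ ζ : Metric.sphere (0 : Cd d) 1, ‖f ((r : ℂ) • (ζ : Cd d))‖ ≤ A) →
      θ * A ^ 2 ≤ ∫ ζ : Metric.sphere (0 : Cd d) 1,
        ‖f ((r : ℂ) • (ζ : Cd d))‖ ^ 2 ∂(sphereMeasure d) →
      κ * A ≤ integralMean p f r ∧ integralMean p f r ≤ A := by
  have := isProbabilityMeasure_sphereMeasure hd
  have : NeZero d := ⟨by omega⟩
  by_cases hp' : p = ∞
  · refine ⟨√θ, Real.sqrt_pos.2 hθ, fun f r A hr hA hcont hle h2 => ?_⟩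
    simp only [integralMean, hp', if_true]
    have hmem : ∀ ζ : Metric.sphere (0 : Cd d) 1, (r : ℂ) • (ζ : Cd d) ∈ Metric.sphere 0 r := by
      intro ζ
      simp [norm_smul, abs_of_nonneg hr]
    have hall : ∀ y ∈ (fun z => ‖f z‖) '' Metric.sphere (0 : Cd d) r, y ≤ A := by
      rintro _ ⟨z, hz, rfl⟩
      rw [mem_sphere_zero_iff_norm] at hz
      obtain ⟨u, hu, hzu⟩ := exists_unit_smul_norm z
      rw [hzu, hz]
      exact hle ⟨u, mem_sphere_zero_iff_norm.2 hu⟩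
    obtain ⟨u, hu⟩ := exists_norm_eq (Cd d) zero_le_one
    have hne : ((fun z => ‖f z‖) '' Metric.sphere (0 : Cd d) r).Nonempty :=
      ⟨_, _, hmem ⟨u, mem_sphere_zero_iff_norm.2 hu⟩, rfl⟩
    refine ⟨?_, csSup_le hne hall⟩
    set s := sSup ((fun z => ‖f z‖) '' Metric.sphere (0 : Cd d) r) with hs
    have hles : ∀ ζ : Metric.sphere (0 : Cd d) 1, ‖f ((r : ℂ) • (ζ : Cd d))‖ ≤ s := fun ζ =>
      le_csSup ⟨A, hall⟩ ⟨_, hmem ζ, rfl⟩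
    have hs0 : 0 ≤ s := (norm_nonneg _).trans (hles ⟨u, mem_sphere_zero_iff_norm.2 hu⟩)
    refine (sq_le_sq₀ (by positivity) hs0).1 ?_
    rw [mul_pow, Real.sq_sqrt hθ.le]
    refine h2.trans ((integral_mono (Continuous.integrable_of_compactSpace (hcont.norm.pow 2))
      (integrable_const (s ^ 2)) fun ζ => pow_le_pow_left₀ (norm_nonneg _) (hles ζ) 2).trans
      (le_of_eq ?_))
    simp
  · have hq : 0 < p.toReal := ENNReal.toReal_pos hp.ne' hp'
    refine ⟨((θ / 2) ^ (p.toReal / 2) * (θ / 2)) ^ (1 / p.toReal), by positivity,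
      fun f r A hr hA hcont hle h2 => ?_⟩
    simp only [integralMean, hp', if_false]
    exact rpow_integral_mean_bounds (g := fun ζ : Metric.sphere (0 : Cd d) 1 =>
      ‖f ((r : ℂ) • (ζ : Cd d))‖) hcont.norm (fun ζ => norm_nonneg _) hA hle hθ hq h2

theorem theorem1p1 (d : ℕ) (hd : 1 ≤ d) (w : ℝ → ℝ) (hw : IsLogConvexWeight w) :
    ∃ f : Cd d → ℂ, HolBall d f ∧
      ∀ p : ℝ≥0∞, 0 < p → EquivOn (Set.Ico (0 : ℝ) 1) (integralMean p f) w := by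
  have := isProbabilityMeasure_sphereMeasure hd
  have : NeZero d := ⟨by omega⟩
  obtain ⟨n, a, c, B, hn, ha, hc, hB, hser⟩ := hw.exists_power_series
  obtain ⟨C, hC1, hex⟩ := exists_bounded_homogeneous hd
  choose V hVd hVh hVC hVint using hex
  have hC0 : 0 < C := by linarith
  set f : Cd d → ℂ := fun z => ∑' k, (a k : ℂ) * V (n k) z with hf
  have hVcont : ∀ m, Continuous (V m) := fun m => (hVd m).continuous
  have hunit : ∀ ζ : Metric.sphere (0 : Cd d) 1, ‖(ζ : Cd d)‖ = 1 := fun ζ => by simp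
  have hfr : ∀ (r : ℝ) (ζ : Metric.sphere (0 : Cd d) 1),
      f ((r : ℂ) • (ζ : Cd d)) = ∑' k, ((a k * r ^ n k : ℝ) : ℂ) * V (n k) ζ := by
    intro r ζ
    refine tsum_congr fun k => ?_
    rw [hVh]
    push_cast
    ring
  refine ⟨f, differentiableOn_tsum_homogeneous (fun k => hVd (n k)) (fun k => hVh (n k))
    (fun k => hVC (n k)) ha fun r hr => (hser r hr).1, fun p hp => ?_⟩
  -- With `A = C * B * w r`, this `θ` makes `θ * A ^ 2 = (c * w r) ^ 2 / 2`, the Bessel lower bound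
  -- from the largest term; `κ` does not depend on `r`.
  obtain ⟨κ, hκ, hbd⟩ := integralMean_bounds hd hp (θ := c ^ 2 / 2 / (C * B) ^ 2) (by positivity)
  refine ⟨1 / (C * B), 1 / (κ * (C * B)), by positivity, by positivity, fun r hr => ?_⟩
  obtain ⟨hsum, hle, k, hk⟩ := hser r hr
  have hwr := hw.pos r hr
  have hb0 : ∀ k, 0 ≤ a k * r ^ n k := fun k => mul_nonneg (ha k) (pow_nonneg hr.1 _)
  have hterm : ∀ (k : ℕ) (ζ : Metric.sphere (0 : Cd d) 1),
      ‖((a k * r ^ n k : ℝ) : ℂ) * V (n k) ζ‖ ≤ a k * r ^ n k * C := fun k ζ => by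
    rw [norm_mul, Complex.norm_real, Real.norm_of_nonneg (hb0 k)]
    exact mul_le_mul_of_nonneg_left (hVC _ _ (hunit ζ)) (hb0 k)
  have hmain := hbd f r (C * B * w r) hr.1 (by positivity) ?_ ?_ ?_
  · obtain ⟨hlow, hup⟩ := hmain
    constructor
    · rw [one_div_mul_eq_div, div_le_iff₀ (by positivity)]
      linarith
    · rw [one_div_mul_eq_div, le_div_iff₀ (by positivity)]
      linarith
  · simp only [hfr]
    exact continuous_tsum (fun k => by have := hVcont (n k); fun_prop) (hsum.mul_right C) hterm
  · intro ζ
    rw [hfr]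
    refine (tsum_of_norm_bounded (hsum.mul_right C).hasSum fun k => hterm k ζ).trans ?_
    rw [tsum_mul_right]
    nlinarith
  · simp only [hfr]
    refine le_trans ?_ (sq_mul_integral_sq_le_of_orthogonal
      (V := fun k (ζ : Metric.sphere (0 : Cd d) 1) => V (n k) ζ)
      (fun k => (hVcont (n k)).comp continuous_subtype_val) (fun k ζ => hVC _ _ (hunit ζ))
      (fun j k hjk => integral_mul_conj_eq_zero_of_homogeneous (hn.injective.ne hjk) (hVcont _)
        (hVcont _) (hVh _) (hVh _)) hb0 hsum k)
    calc c ^ 2 / 2 / (C * B) ^ 2 * (C * B * w r) ^ 2 = (c * w r) ^ 2 * (1 / 2) := by field_simp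
      _ ≤ _ := by
        have := hVint (n k)
        gcongr
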